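/- Let $m,n\ge 1$ be integers with $m(n-1)$ even, let $\mathbf h=(h_0,h_1,\dots,h_{m(n-1)})\in\mathbb R^{m(n-1)+1}$, and let $\mathcal H$ be the $m$-th order $n$-dimensional Hankel tensor generated by $\mathbf h$, i.e. $\mathcal H_{i_1\dots i_m}=h_{i_1+\dots+i_m}$ for $0\le i_1,\dots,i_m\le n-1$. Its associated Hankel matrix is the square matrix $H=(h_{i+j})_{i,j=0}^{m(n-1)/2}$. The tensor $\mathcal H$ is called a strong Hankel tensor if $H$ is positive semi-definite. For $\mathbf v\in\mathbb R^n$ let $\mathbf v^{\circ m}$ be the tensor with entries $v_{i_1}v_{i_2}\cdots v_{i_m}$, and let $\mathbf e_n=(0,\dots,0,1)^\top\in\mathbb R^n$. Let $r=\operatorname{rank}(H)$. Then $\mathcal H$ is a strong Hankel tensor if and only if it admits a Vandermonde decomposition with all positive coefficients $$\mathcal H=\sum_{k=1}^{r}\alpha_k\mathbf v_k^{\circ m},\qquad \alpha_k>0,\quad \mathbf v_k=(1,\xi_k,\dots,\xi_k^{n-1})^\top,\quad \xi_k\in\mathbb R,$$ or, with $r\ge 1$, an augmented Vandermonde decomposition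 with all positive coefficients $$\mathcal H=\sum_{k=1}^{r-1}\alpha_k\mathbf v_k^{\circ m}+\alpha_r\mathbf e_n^{\circ m},\qquad \alpha_k>0,\quad \mathbf v_k=(1,\xi_k,\dots,\xi_k^{n-1})^\top,\quad \xi_k\in\mathbb R.$$ (An empty sum is zero.) -/

import Mathlib

/-- Real `m`-th order `n`-dimensional (square) tensors, with 0-based indices. -/
abbrev RealTensor (m n : ℕ) : Type := (Fin m → Fin n) → ℝ

/-- The sum of `m` indices, each in `{0, …, n - 1}`, lies in `{0, …, m (n - 1)}`. -/
theorem index_sum_lt {m n : ℕ} (i : Fin m → Fin n) :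
    ∑ k, (i k : ℕ) < m * (n - 1) + 1 := by
  have h : ∑ k, (i k : ℕ) ≤ ∑ _k : Fin m, (n - 1) :=
    Finset.sum_le_sum fun k _ => by have := (i k).isLt; omega
  simp only [Finset.sum_const, Finset.card_univ, Fintype.card_fin, smul_eq_mul] at h
  omega

/-- The Hankel tensor generated by `h = (h_0, …, h_{m (n - 1)})`: its entry at
`(i_1, …, i_m)` is `h_{i_1 + ⋯ + i_m}`. -/
def hankelTensor (m n : ℕ) (h : Fin (m * (n - 1) + 1) → ℝ) : RealTensor m n :=
  fun i => h ⟨∑ k, (i k : ℕ), index_sum_lt i⟩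

/-- The square Hankel matrix generated by `h = (h_0, …, h_{m (n - 1)})`, of size
`m (n - 1) / 2 + 1`, with entries `h_{i + j}`. This is the associated Hankel matrix of the
Hankel tensor generated by `h`; it is meant for even `m (n - 1)`, which is exactly the case in
which `h` has the right length to generate a square Hankel matrix. -/
def associatedHankelMatrix (m n : ℕ) (h : Fin (m * (n - 1) + 1) → ℝ) :
    Matrix (Fin (m * (n - 1) / 2 + 1)) (Fin (m * (n - 1) / 2 + 1)) ℝ :=
  fun i j => h ⟨(i : ℕ) + (j : ℕ), by have := i.isLt; have := j.isLt; omega⟩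

/-- A strong Hankel tensor: a Hankel tensor whose associated Hankel matrix is positive
semi-definite (used for even `m (n - 1)`). -/
def IsStrongHankelTensor {m n : ℕ} (T : RealTensor m n) : Prop :=
  ∃ h : Fin (m * (n - 1) + 1) → ℝ,
    T = hankelTensor m n h ∧ (associatedHankelMatrix m n h).PosSemidef

/-- The outer product `v_1 ∘ v_2 ∘ ⋯ ∘ v_m`. -/
def outerProduct {m n : ℕ} (v : Fin m → Fin n → ℝ) : RealTensor m n :=
  fun i => ∏ k, v k (i k)

/-- The symmetric rank-one tensor `v^{∘ m} = v ∘ v ∘ ⋯ ∘ v` (`m` times). -/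
def outerPower (m : ℕ) {n : ℕ} (v : Fin n → ℝ) : RealTensor m n :=
  outerProduct fun _ => v

/-- The Vandermonde vector `(1, ξ, ξ ^ 2, …, ξ ^ (n - 1))`. -/
def vandermondeVector (n : ℕ) (ξ : ℝ) : Fin n → ℝ := fun i => ξ ^ (i : ℕ)

/-- The last unit vector `e_n = (0, …, 0, 1)`. -/
def lastUnitVector (n : ℕ) : Fin n → ℝ := fun i => if (i : ℕ) + 1 = n then 1 else 0

/-- `T` has a Vandermonde decomposition `∑_{k = 1}^r α_k v_k^{∘ m}` with all `α_k > 0`. -/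
def HasPositiveVandermondeDecomposition {m n : ℕ} (T : RealTensor m n) (r : ℕ) : Prop :=
  ∃ α ξ : Fin r → ℝ, (∀ k, 0 < α k) ∧
    T = ∑ k, α k • outerPower m (vandermondeVector n (ξ k))

/-- `T` has an augmented Vandermonde decomposition
`∑_{k = 1}^{r - 1} α_k v_k^{∘ m} + α_r e_n^{∘ m}` with all `α_k > 0`; here `r ≥ 1`, `s = r - 1`
and `β = α_r`. -/
def HasPositiveAugmentedVandermondeDecomposition {m n : ℕ} (T : RealTensor m n) (r : ℕ) :
    Prop :=
  ∃ s : ℕ, r = s + 1 ∧ ∃ (α ξ : Fin s → ℝ) (β : ℝ), (∀ k, 0 < α k) ∧ 0 < β ∧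
    T = ∑ k, α k • outerPower m (vandermondeVector n (ξ k)) +
      β • outerPower m (lastUnitVector n)

/-!
A positive semidefinite Hankel matrix `H` is the Gram matrix of vectors `v₀, …, v_p`. Being Hankel
means `⟪v_{i+1}, v_j⟫ = ⟪v_i, v_{j+1}⟫`, so that the shift `v_i ↦ v_{i+1}`, compressed to the span
`W` of `v₀, …, v_{p-1}`, is a well-defined symmetric operator `A` with cyclic vector
`x = P v₀`, where `P` is the orthogonal projection onto `W`. Diagonalising `A` writes
`⟪P v_i, P v_j⟫ = ⟪x, A ^ (i + j) x⟫` as a moment of a positive measure with `dim W` atoms. Only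
`v_p` may leave `W`, which adds `β = dist (v_p, W) ^ 2` to the last entry of `H`: this is the
coefficient of `e_n^{∘ m}`, and it is nonzero exactly when `rank H = dim W + 1`.

Conversely, each term of a decomposition of the tensor contributes a positive semidefinite rank-one
matrix to `H`.
-/

open Matrix Module Submodule
open scoped InnerProductSpace

section LinearAlgebra

theorem finrank_span_insert {K V : Type*} [DivisionRing K] [AddCommGroup V] [Module K V]
    [FiniteDimensional K V] (x : V) (s : Set V) [Decidable (x ∈ span K s)] :
    finrank K (span K (insert x s)) =
      if x ∈ span K s then finrank K (span K s) else finrank K (span K s) + 1 := by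
  split_ifs with hx
  · rw [span_insert_eq_span hx]
  · rw [span_insert, sup_comm, finrank_sup_span_singleton hx]

variable {𝕜 E : Type*} [RCLike 𝕜] [NormedAddCommGroup E] [InnerProductSpace 𝕜 E]

theorem eq_zero_of_forall_inner_eq_zero_of_span_eq_top {ι : Type*} {v : ι → E}
    (hv : span 𝕜 (Set.range v) = ⊤) {x : E} (hx : ∀ i, ⟪x, v i⟫_𝕜 = 0) : x = 0 := by
  have hzero : innerₛₗ 𝕜 x = 0 := LinearMap.ext_on_range hv hx
  exact inner_self_eq_zero.1 (LinearMap.congr_fun hzero x)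

theorem exists_isSymmetric_apply_eq {ι : Type*} {v w : ι → E}
    (hv : span 𝕜 (Set.range v) = ⊤) (hvw : ∀ i j, ⟪w i, v j⟫_𝕜 = ⟪v i, w j⟫_𝕜) :
    ∃ A : E →ₗ[𝕜] E, A.IsSymmetric ∧ ∀ i, A (v i) = w i := by
  let V := Finsupp.linearCombination 𝕜 v
  let W := Finsupp.linearCombination 𝕜 w
  have hVW : ∀ a b, ⟪W a, V b⟫_𝕜 = ⟪V a, W b⟫_𝕜 := fun a b => by
    simp only [V, W, Finsupp.linearCombination_apply, Finsupp.sum_inner, Finsupp.inner_sum,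
      inner_smul_left, inner_smul_right, hvw]
  have hV : LinearMap.range V = ⊤ := by rw [Finsupp.range_linearCombination, hv]
  -- Any right inverse `g` will do: by `hVW`, the value `V a` determines `W a`.
  obtain ⟨g, hg⟩ := V.exists_rightInverse_of_surjective hV
  have hVg : ∀ x, V (g x) = x := LinearMap.congr_fun hg
  refine ⟨W ∘ₗ g, fun x y => ?_, fun i => ext_inner_right 𝕜 fun y => ?_⟩
  · simpa only [LinearMap.comp_apply, hVg] using hVW (g x) (g y)
  · calc ⟪W (g (v i)), y⟫_𝕜
      _ = ⟪v i, W (g y)⟫_𝕜 := by simpa only [hVg] using hVW (g (v i)) (g y)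
      _ = ⟪w i, y⟫_𝕜 := by simpa [V, W, hVg] using (hVW (Finsupp.single i 1) (g y)).symm

end LinearAlgebra

section Spectral

variable {𝕜 E : Type*} [RCLike 𝕜] [NormedAddCommGroup E] [InnerProductSpace 𝕜 E]
  [FiniteDimensional 𝕜 E] {A : E →ₗ[𝕜] E} {d : ℕ}

theorem inner_eigenvectorBasis_pow_apply (hA : A.IsSymmetric) (hd : finrank 𝕜 E = d) (x : E)
    (k : Fin d) (j : ℕ) :
    ⟪hA.eigenvectorBasis hd k, (A ^ j) x⟫_𝕜 =
      (hA.eigenvalues hd k : 𝕜) ^ j * ⟪hA.eigenvectorBasis hd k, x⟫_𝕜 := by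
  induction j with
  | zero => simp
  | succ j ih =>
    rw [pow_succ', Module.End.mul_apply, ← OrthonormalBasis.repr_apply_apply,
      hA.eigenvectorBasis_apply_self_apply, OrthonormalBasis.repr_apply_apply, ih, pow_succ',
      mul_assoc]

theorem inner_pow_apply_eq_sum_eigenvalues (hA : A.IsSymmetric) (hd : finrank 𝕜 E = d) (x : E)
    (j : ℕ) :
    ⟪x, (A ^ j) x⟫_𝕜 =
      ((∑ k, ‖⟪hA.eigenvectorBasis hd k, x⟫_𝕜‖ ^ 2 * hA.eigenvalues hd k ^ j : ℝ) : 𝕜) := by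
  rw [← (hA.eigenvectorBasis hd).sum_inner_mul_inner]
  push_cast
  refine Finset.sum_congr rfl fun k _ => ?_
  rw [inner_eigenvectorBasis_pow_apply, ← inner_conj_symm, mul_left_comm, RCLike.conj_mul,
    mul_comm]

theorem inner_eigenvectorBasis_ne_zero_of_cyclic (hA : A.IsSymmetric) (hd : finrank 𝕜 E = d)
    {x : E} (hx : span 𝕜 (Set.range fun j : ℕ => (A ^ j) x) = ⊤) (k : Fin d) :
    ⟪hA.eigenvectorBasis hd k, x⟫_𝕜 ≠ 0 := fun hk =>
  (hA.eigenvectorBasis hd).orthonormal.ne_zero k <|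
    eq_zero_of_forall_inner_eq_zero_of_span_eq_top hx fun j => by
      rw [inner_eigenvectorBasis_pow_apply, hk, mul_zero]

theorem exists_pos_inner_pow_apply_eq_sum_of_cyclic (hA : A.IsSymmetric)
    {x : E} (hx : span 𝕜 (Set.range fun j : ℕ => (A ^ j) x) = ⊤) :
    ∃ α ξ : Fin (finrank 𝕜 E) → ℝ, (∀ k, 0 < α k) ∧
      ∀ j : ℕ, ⟪x, (A ^ j) x⟫_𝕜 = ((∑ k, α k * ξ k ^ j : ℝ) : 𝕜) :=
  ⟨fun k => ‖⟪hA.eigenvectorBasis rfl k, x⟫_𝕜‖ ^ 2, hA.eigenvalues rfl,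
    fun k => pow_pos (norm_pos_iff.2 (inner_eigenvectorBasis_ne_zero_of_cyclic hA rfl hx k)) 2,
    inner_pow_apply_eq_sum_eigenvalues hA rfl x⟩

end Spectral

section Gram

variable {𝕜 E n : Type*} [RCLike 𝕜] [NormedAddCommGroup E] [InnerProductSpace 𝕜 E] [Fintype n]

theorem ker_mulVecLin_gram (v : n → E) :
    LinearMap.ker (gram 𝕜 v).mulVecLin = LinearMap.ker (Fintype.linearCombination 𝕜 v) := by
  ext y
  simp only [LinearMap.mem_ker, mulVecLin_apply, Fintype.linearCombination_apply]
  constructor <;> intro hy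
  · rw [← inner_self_eq_zero (𝕜 := 𝕜), ← star_dotProduct_gram_mulVec, hy, dotProduct_zero]
  · ext i
    calc (gram 𝕜 v *ᵥ y) i
      _ = ⟪v i, ∑ j, y j • v j⟫_𝕜 := by
        simp only [mulVec, dotProduct, gram_apply, inner_sum, inner_smul_right, mul_comm]
      _ = 0 := by rw [hy, inner_zero_right]

theorem rank_gram (v : n → E) : (gram 𝕜 v).rank = finrank 𝕜 (span 𝕜 (Set.range v)) := by
  have hgram := (gram 𝕜 v).mulVecLin.finrank_range_add_finrank_ker
  have hcomb := (Fintype.linearCombination 𝕜 v).finrank_range_add_finrank_ker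
  rw [Fintype.range_linearCombination] at hcomb
  rw [ker_mulVecLin_gram] at hgram
  exact Nat.add_right_cancel (hgram.trans hcomb.symm)

open scoped ComplexOrder MatrixOrder in
theorem exists_eq_gram_of_posSemidef {M : Matrix n n 𝕜} (hM : M.PosSemidef) :
    ∃ v : n → EuclideanSpace 𝕜 n, M = gram 𝕜 v := by
  classical
  obtain ⟨B, rfl⟩ := CStarAlgebra.nonneg_iff_eq_star_mul_self.1 hM.nonneg
  refine ⟨fun j => WithLp.toLp 2 (B.col j), ?_⟩
  ext i j
  simp [mul_apply, PiLp.inner_apply, mul_comm]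

end Gram

section CompressedShift

variable {𝕜 E : Type*} [RCLike 𝕜] [NormedAddCommGroup E] [InnerProductSpace 𝕜 E] {p : ℕ}

variable (𝕜) in
/-- The span of all vectors of a finite sequence but the last: the space on which the shift
`v i ↦ v (i + 1)` is compressed. -/
abbrev initSpan (v : Fin (p + 1) → E) : Submodule 𝕜 E := span 𝕜 (Set.range (Fin.init v))

instance finiteDimensional_initSpan (v : Fin (p + 1) → E) : FiniteDimensional 𝕜 (initSpan 𝕜 v) :=
  FiniteDimensional.span_of_finite 𝕜 (Set.finite_range _)

theorem castSucc_mem_initSpan (v : Fin (p + 1) → E) (i : Fin p) : v i.castSucc ∈ initSpan 𝕜 v :=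
  subset_span ⟨i, rfl⟩

theorem orthogonalProjectionOnto_initSpan_castSucc (v : Fin (p + 1) → E) (i : Fin p) :
    (initSpan 𝕜 v).orthogonalProjectionOnto (v i.castSucc) =
      ⟨v i.castSucc, castSucc_mem_initSpan v i⟩ :=
  orthogonalProjectionOnto_mem_subspace_eq_self
    (⟨v i.castSucc, castSucc_mem_initSpan v i⟩ : initSpan 𝕜 v)

theorem span_range_orthogonalProjectionOnto_castSucc (v : Fin (p + 1) → E) :
    span 𝕜 (Set.range fun i : Fin p =>
      (initSpan 𝕜 v).orthogonalProjectionOnto (v i.castSucc)) = ⊤ := by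
  simp only [orthogonalProjectionOnto_initSpan_castSucc]
  refine map_injective_of_injective (initSpan 𝕜 v).injective_subtype ?_
  rw [map_span, ← Set.range_comp, Submodule.map_top, range_subtype]
  rfl

theorem finrank_span_range_eq_ite_initSpan [FiniteDimensional 𝕜 E] (v : Fin (p + 1) → E)
    [Decidable (v (Fin.last p) ∈ initSpan 𝕜 v)] :
    finrank 𝕜 (span 𝕜 (Set.range v)) = if v (Fin.last p) ∈ initSpan 𝕜 v then
      finrank 𝕜 (initSpan 𝕜 v) else finrank 𝕜 (initSpan 𝕜 v) + 1 := by
  have hrange : Set.range v = insert (v (Fin.last p)) (Set.range (Fin.init v)) := by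
    rw [← Fin.range_snoc, Fin.snoc_init_self]
  rw [hrange]
  exact finrank_span_insert _ _

theorem inner_eq_inner_orthogonalProjectionOnto_initSpan_add (v : Fin (p + 1) → E)
    (i j : Fin (p + 1)) :
    ⟪v i, v j⟫_𝕜 = ⟪(initSpan 𝕜 v).orthogonalProjectionOnto (v i),
        (initSpan 𝕜 v).orthogonalProjectionOnto (v j)⟫_𝕜 +
      if i = Fin.last p ∧ j = Fin.last p then
        ((‖(initSpan 𝕜 v)ᗮ.orthogonalProjectionOnto (v (Fin.last p))‖ ^ 2 : ℝ) : 𝕜) else 0 := by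
  induction i using Fin.lastCases with
  | cast i => simp [orthogonalProjectionOnto_initSpan_castSucc, i.castSucc_ne_last]
  | last =>
    induction j using Fin.lastCases with
    | cast j => simp [orthogonalProjectionOnto_initSpan_castSucc, j.castSucc_ne_last]
    | last =>
      rw [if_pos ⟨rfl, rfl⟩, inner_self_eq_norm_sq_to_K, inner_self_eq_norm_sq_to_K]
      exact_mod_cast norm_sq_eq_add_norm_sq_projection (v (Fin.last p)) (initSpan 𝕜 v)

theorem exists_isSymmetric_pow_apply_eq_orthogonalProjectionOnto {v : Fin (p + 1) → E}
    (hv : ∀ i j : Fin p, ⟪v i.succ, v j.castSucc⟫_𝕜 = ⟪v i.castSucc, v j.succ⟫_𝕜) :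
    ∃ A : initSpan 𝕜 v →ₗ[𝕜] initSpan 𝕜 v, A.IsSymmetric ∧ ∀ j : Fin (p + 1),
      (A ^ (j : ℕ)) ((initSpan 𝕜 v).orthogonalProjectionOnto (v 0)) =
        (initSpan 𝕜 v).orthogonalProjectionOnto (v j) := by
  obtain ⟨A, hA, hshift⟩ := exists_isSymmetric_apply_eq
    (w := fun i : Fin p => (initSpan 𝕜 v).orthogonalProjectionOnto (v i.succ))
    (span_range_orthogonalProjectionOnto_castSucc v)
    (by simpa [orthogonalProjectionOnto_initSpan_castSucc] using hv)
  refine ⟨A, hA, fun j => ?_⟩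
  induction j using Fin.induction with
  | zero => simp
  | succ j ih =>
    rw [Fin.val_succ, pow_succ', Module.End.mul_apply, ← hshift, ← ih, Fin.val_castSucc]

end CompressedShift

section Moments

variable {ι : Type*} [Fintype ι]

/-- The `j`-th moment of the measure `∑ k, α k • δ_{ξ k} + β • δ_∞` on the projective line, for
moments up to order `N`: the mass `β` at infinity is only seen by the top moment `j = N`. -/
def augmentedMoment (N : ℕ) (α ξ : ι → ℝ) (β : ℝ) (j : ℕ) : ℝ :=
  ∑ k, α k * ξ k ^ j + if j = N then β else 0

/-- The `(p + 1) × (p + 1)` Hankel matrix generated by the first `2 * p + 1` terms of a sequence. -/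
def hankelMatrix {R : Type*} (p : ℕ) (h : ℕ → R) : Matrix (Fin (p + 1)) (Fin (p + 1)) R :=
  of fun i j => h (i + j)

theorem eq_of_hankelMatrix_eq {R : Type*} {p : ℕ} {g h : ℕ → R}
    (hgh : hankelMatrix p g = hankelMatrix p h) {j : ℕ} (hj : j ≤ 2 * p) : g j = h j := by
  have hentry := congrFun₂ hgh ⟨min j p, by omega⟩ ⟨j - min j p, by omega⟩
  have hsum : min j p + (j - min j p) = j := by omega
  simpa [hankelMatrix, hsum] using hentry

theorem exists_augmentedMoment_of_inner_hankel {E : Type*} [NormedAddCommGroup E]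
    [InnerProductSpace ℝ E] {p : ℕ} {v : Fin (p + 1) → E}
    (hv : ∀ i j : Fin p, ⟪v i.succ, v j.castSucc⟫_ℝ = ⟪v i.castSucc, v j.succ⟫_ℝ) :
    ∃ (α ξ : Fin (finrank ℝ (initSpan ℝ v)) → ℝ) (β : ℝ), (∀ k, 0 < α k) ∧ 0 ≤ β ∧
      (β = 0 ↔ v (Fin.last p) ∈ initSpan ℝ v) ∧
      gram ℝ v = hankelMatrix p (augmentedMoment (2 * p) α ξ β) := by
  obtain ⟨A, hA, hpow⟩ := exists_isSymmetric_pow_apply_eq_orthogonalProjectionOnto hv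
  set x := (initSpan ℝ v).orthogonalProjectionOnto (v 0)
  have hcyclic : span ℝ (Set.range fun j : ℕ => (A ^ j) x) = ⊤ := by
    rw [eq_top_iff, ← span_range_orthogonalProjectionOnto_castSucc v]
    refine span_mono ?_
    rintro _ ⟨i, rfl⟩
    exact ⟨i, hpow i.castSucc⟩
  obtain ⟨α, ξ, hα, hmoment⟩ := exists_pos_inner_pow_apply_eq_sum_of_cyclic hA hcyclic
  refine ⟨α, ξ, ‖(initSpan ℝ v)ᗮ.orthogonalProjectionOnto (v (Fin.last p))‖ ^ 2, hα,
    by positivity, ?_, ?_⟩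
  · rw [sq_eq_zero_iff, norm_eq_zero, orthogonalProjectionOnto_eq_zero_iff, orthogonal_orthogonal]
  · ext i j
    have hlast : i = Fin.last p ∧ j = Fin.last p ↔ (i : ℕ) + j = 2 * p := by
      simp only [Fin.ext_iff, Fin.val_last]
      omega
    rw [gram_apply, inner_eq_inner_orthogonalProjectionOnto_initSpan_add, ← hpow i, ← hpow j,
      hA.pow, ← Module.End.mul_apply, ← pow_add, hmoment]
    simp [hankelMatrix, augmentedMoment, hlast]

theorem exists_augmentedMoment_of_posSemidef_hankelMatrix {p : ℕ} {h : ℕ → ℝ}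
    (hpos : (hankelMatrix p h).PosSemidef) :
    ∃ (d : ℕ) (α ξ : Fin d → ℝ) (β : ℝ), (∀ k, 0 < α k) ∧ 0 ≤ β ∧
      (∀ j ≤ 2 * p, h j = augmentedMoment (2 * p) α ξ β j) ∧
      (hankelMatrix p h).rank = if β = 0 then d else d + 1 := by
  classical
  obtain ⟨v, hv⟩ := exists_eq_gram_of_posSemidef hpos
  have hinner : ∀ i j, ⟪v i, v j⟫_ℝ = h (i + j) := fun i j => (congrFun₂ hv i j).symm
  obtain ⟨α, ξ, β, hα, hβ, hβ0, hgram⟩ := exists_augmentedMoment_of_inner_hankel (v := v)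
    fun i j => by simp [hinner, add_right_comm, add_assoc]
  refine ⟨_, α, ξ, β, hα, hβ, fun j => eq_of_hankelMatrix_eq (hv.trans hgram), ?_⟩
  simp only [hv, rank_gram, finrank_span_range_eq_ite_initSpan, hβ0]

theorem hankelMatrix_augmentedMoment (p : ℕ) (α ξ : ι → ℝ) (β : ℝ) :
    hankelMatrix p (augmentedMoment (2 * p) α ξ β) =
      ∑ k, α k • vecMulVec (vandermondeVector (p + 1) (ξ k)) (vandermondeVector (p + 1) (ξ k)) +
        β • vecMulVec (lastUnitVector (p + 1)) (lastUnitVector (p + 1)) := by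
  ext i j
  have hlast : (i : ℕ) + j = 2 * p ↔ (j : ℕ) = p ∧ (i : ℕ) = p := by omega
  simp [hankelMatrix, augmentedMoment, vandermondeVector, lastUnitVector, Matrix.sum_apply,
    vecMulVec_apply, pow_add, hlast, ite_and]

theorem posSemidef_hankelMatrix_augmentedMoment (p : ℕ) {α : ι → ℝ} (hα : ∀ k, 0 ≤ α k)
    (ξ : ι → ℝ) {β : ℝ} (hβ : 0 ≤ β) :
    (hankelMatrix p (augmentedMoment (2 * p) α ξ β)).PosSemidef := by
  rw [hankelMatrix_augmentedMoment]
  exact (posSemidef_sum _ fun k _ => (posSemidef_vecMulVec_self_star _).smul (hα k)).add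
    ((posSemidef_vecMulVec_self_star _).smul hβ)

end Moments

section HankelTensor

variable {m n : ℕ}

theorem exists_index_sum_eq (hn : 1 ≤ n) {s : ℕ} (hs : s ≤ m * (n - 1)) :
    ∃ i : Fin m → Fin n, ∑ k, (i k : ℕ) = s := by
  induction m generalizing s with
  | zero => exact ⟨Fin.elim0, by simpa [eq_comm] using hs⟩
  | succ m ih =>
    rw [Nat.succ_mul] at hs
    obtain ⟨i, hi⟩ := ih (s := s - min s (n - 1)) (by omega)
    refine ⟨Fin.cons ⟨min s (n - 1), by omega⟩ i, ?_⟩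
    simp only [Fin.sum_univ_succ, Fin.cons_zero, Fin.cons_succ, hi]
    omega

theorem hankelTensor_injective (hn : 1 ≤ n) : Function.Injective (hankelTensor m n) := by
  intro g h hgh
  funext ⟨s, hs⟩
  obtain ⟨i, rfl⟩ := exists_index_sum_eq hn (Nat.le_of_lt_succ hs)
  exact congrFun hgh i

theorem outerPower_vandermondeVector_apply (ξ : ℝ) (i : Fin m → Fin n) :
    outerPower m (vandermondeVector n ξ) i = ξ ^ ∑ k, (i k : ℕ) :=
  Finset.prod_pow_eq_pow_sum Finset.univ (fun k => (i k : ℕ)) ξ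

theorem index_sum_eq_max_iff (i : Fin m → Fin n) :
    ∑ k, (i k : ℕ) = m * (n - 1) ↔ ∀ k, (i k : ℕ) + 1 = n := by
  have hle : ∀ k ∈ Finset.univ, (i k : ℕ) ≤ n - 1 := fun k _ => Nat.le_sub_one_of_lt (i k).isLt
  have hsum := Finset.sum_eq_sum_iff_of_le hle
  simp only [Finset.sum_const, Finset.card_univ, Fintype.card_fin, smul_eq_mul, Finset.mem_univ,
    true_implies] at hsum
  rw [hsum]
  exact forall_congr' fun k => by have := (i k).isLt; omega

theorem outerPower_lastUnitVector_apply (i : Fin m → Fin n) :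
    outerPower m (lastUnitVector n) i = if ∑ k, (i k : ℕ) = m * (n - 1) then 1 else 0 := by
  simp only [outerPower, outerProduct, lastUnitVector, Finset.prod_ite_zero, Finset.mem_univ,
    true_implies, Finset.prod_const_one, index_sum_eq_max_iff]

theorem hankelTensor_augmentedMoment {ι : Type*} [Fintype ι] (α ξ : ι → ℝ) (β : ℝ) :
    hankelTensor m n (fun s => augmentedMoment (m * (n - 1)) α ξ β s) =
      ∑ k, α k • outerPower m (vandermondeVector n (ξ k)) +
        β • outerPower m (lastUnitVector n) := by
  funext i
  simp [hankelTensor, augmentedMoment, outerPower_vandermondeVector_apply,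
    outerPower_lastUnitVector_apply]

theorem isStrongHankelTensor_sum_add (heven : Even (m * (n - 1))) {ι : Type*} [Fintype ι]
    {α : ι → ℝ} (hα : ∀ k, 0 ≤ α k) (ξ : ι → ℝ) {β : ℝ} (hβ : 0 ≤ β) :
    IsStrongHankelTensor (∑ k, α k • outerPower m (vandermondeVector n (ξ k)) +
      β • outerPower m (lastUnitVector n)) := by
  refine ⟨_, (hankelTensor_augmentedMoment α ξ β).symm, ?_⟩
  have hpos := posSemidef_hankelMatrix_augmentedMoment (m * (n - 1) / 2) hα ξ hβ
  rwa [Nat.two_mul_div_two_of_even heven] at hpos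

theorem exists_eq_augmentedMoment_of_posSemidef (heven : Even (m * (n - 1)))
    {h : Fin (m * (n - 1) + 1) → ℝ} (hpos : (associatedHankelMatrix m n h).PosSemidef) :
    ∃ (d : ℕ) (α ξ : Fin d → ℝ) (β : ℝ), (∀ k, 0 < α k) ∧ 0 ≤ β ∧
      h = (fun s : Fin _ => augmentedMoment (m * (n - 1)) α ξ β s) ∧
      (associatedHankelMatrix m n h).rank = if β = 0 then d else d + 1 := by
  have hmatrix : associatedHankelMatrix m n h =
      hankelMatrix (m * (n - 1) / 2) fun s => h (Fin.ofNat _ s) := by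
    ext i j
    refine congrArg h (Fin.ext (Nat.mod_eq_of_lt ?_).symm)
    omega
  rw [hmatrix] at hpos ⊢
  obtain ⟨d, α, ξ, β, hα, hβ, hmoment, hrank⟩ :=
    exists_augmentedMoment_of_posSemidef_hankelMatrix hpos
  rw [Nat.two_mul_div_two_of_even heven] at hmoment
  exact ⟨d, α, ξ, β, hα, hβ,
    funext fun s => by simpa using hmoment s (Nat.le_of_lt_succ s.isLt), hrank⟩

end HankelTensor

theorem mainTheorem2 (m n r : ℕ) (hm : 1 ≤ m) (hn : 1 ≤ n) (heven : Even (m * (n - 1)))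
    (h : Fin (m * (n - 1) + 1) → ℝ) (T : RealTensor m n) (hT : T = hankelTensor m n h)
    (hr : (associatedHankelMatrix m n h).rank = r) :
    IsStrongHankelTensor T ↔
      HasPositiveVandermondeDecomposition T r ∨
        HasPositiveAugmentedVandermondeDecomposition T r := by
  constructor
  · rintro ⟨h', hT', hpos⟩
    obtain rfl : h' = h := hankelTensor_injective hn (hT'.symm.trans hT)
    obtain ⟨d, α, ξ, β, hα, hβ, rfl, hrank⟩ := exists_eq_augmentedMoment_of_posSemidef heven hpos
    rw [hankelTensor_augmentedMoment] at hT
    rw [hr] at hrank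
    split_ifs at hrank with hβ0
    · subst hrank
      exact Or.inl ⟨α, ξ, hα, by rw [hT, hβ0, zero_smul, add_zero]⟩
    · exact Or.inr ⟨d, hrank, α, ξ, β, hα, hβ.lt_of_ne' hβ0, hT⟩
  · rintro (⟨α, ξ, hα, rfl⟩ | ⟨s, -, α, ξ, β, hα, hβ, rfl⟩)
    · simpa using isStrongHankelTensor_sum_add heven (fun k => (hα k).le) ξ le_rfl
    · exact isStrongHankelTensor_sum_add heven (fun k => (hα k).le) ξ hβ.le
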